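/- **Setting.** Fix $m$ qubits. Let $\mathcal P^m=\{I,X,Y,Z\}^m$ (Pauli operators modulo phase), let $\langle P,Q\rangle\in\{0,1\}$ be $0$ iff $P,Q$ commute, and let the pattern $pt(P)\in\mathbb Z_2^m$ have $j$-th bit $0$ iff $P$ acts as the identity on qubit $j$. Let $(G_i)_i$ be a family of $m$-qubit Clifford gates and $\mathcal G_i(A)=G_iAG_i^\dagger$. A *noise model* $\mathcal N$ consists of an initial state $\rho$ such that for every pattern $v$ some $P$ with $pt(P)=v$ has $\mathrm{Tr}(P\rho)\neq0$; for each $i$ a Pauli channel $\Lambda_i=\sum_P p_i^P\,P(\cdot)P^\dagger$ acting after $\mathcal G_i$; and a Pauli channel $\Lambda_M$ acting before the terminating measurement, whose Pauli fidelities depend only on the pattern. All error rates are positive with sum $1$, and all Pauli fidelities $\lambda_i^Q=\sum_P(-1)^{\langle P,Q\rangle}p_i^P$ (and those of $\Lambda_M$) are positive. An *experiment* prepares $\rho$, applies a finite sequence of layers, each a tensor product of noiseless single-qubit unitaries or a noisy gate $\Lambda_i\circ\mathcal G_i$, and then measures a finite POVM after $\Lambda_M$. Two noise models are *indistinguishable*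 if every experiment has the same outcome distribution under both; a real function of noise models is *learnable* if it takes equal values on indistinguishable noise models. Fix one gate $G=G_i$ of the family and write $p^P,\lambda^Q$ for $p_i^P,\lambda_i^Q$. The *pattern transfer graph* of $G$ has vertex set $\mathbb Z_2^m$ and, for each $Q\in\mathcal P^m$, one directed edge $e^Q$ from $pt(G^\dagger QG)$ to $pt(Q)$. Its *cycle space* $Z$ is the space of real linear combinations of edges with zero boundary, where $\partial(u\to v)=v-u$. The *first-order expression* of $p^P$ is $$\hat p^P=\frac1{4^m}\sum_{Q\in\mathcal P^m}(-1)^{\langle P,Q\rangle}\log\lambda^Q+\delta_{P,I}.$$ **Theorem.** (1) For every directed closed walk $v_0,e^{Q_1},v_1,\dots,e^{Q_l},v_l=v_0$ in the pattern transfer graph of $G$, the sum $\sum_{k=1}^l p^{Q_k}$ is learnable to first order: the function $\sum_{k=1}^l\hat p^{Q_k}$ is learnable, and there are constants $C$ and $\varepsilon>0$ with $\bigl|\sum_k p^{Q_k}-\sum_k\hat p^{Q_k}\bigr|\le C\,(1-p^I)^2$ for every noise model with $1-p^I\le\varepsilon$. (2) The cycle space is invariant under the Walsh–Hadamard transform: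 the linear map $W$ with $W(e^Q)=4^{-m}\sum_{R\in\mathcal P^m}(-1)^{\langle Q,R\rangle}e^R$ satisfies $W(Z)=Z$. -/

import Mathlib

open scoped Matrix ComplexOrder

namespace PauliLearning

/-! ## Pauli operators on `m` qubits -/

/-- The four single-qubit Pauli labels. -/
inductive Pauli1 where
  | I | X | Y | Z
  deriving DecidableEq

instance : Fintype Pauli1 where
  elems := {.I, .X, .Y, .Z}
  complete := fun P => by cases P <;> decide

namespace Pauli1

/-- The `2 × 2` matrix of a single-qubit Pauli operator. -/
def toMatrix : Pauli1 → Matrix (Fin 2) (Fin 2) ℂ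
  | I => !![1, 0; 0, 1]
  | X => !![0, 1; 1, 0]
  | Y => !![0, -Complex.I; Complex.I, 0]
  | Z => !![1, 0; 0, -1]

/-- `0` if the two single-qubit Pauli operators commute, `1` otherwise. -/
def inner (P Q : Pauli1) : ZMod 2 :=
  if P = I ∨ Q = I ∨ P = Q then 0 else 1

end Pauli1

/-- Operators on `m` qubits, as matrices in the computational basis. -/
abbrev Op (m : ℕ) := Matrix (Fin m → Fin 2) (Fin m → Fin 2) ℂ

/-- The tensor product of `m` single-qubit operators. -/
def tensor {m : ℕ} (A : Fin m → Matrix (Fin 2) (Fin 2) ℂ) : Op m :=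
  Matrix.of fun a b => ∏ j, A j (a j) (b j)

/-- The `m`-qubit Pauli group modulo phase, `{I, X, Y, Z}^m`. -/
abbrev Pauli (m : ℕ) := Fin m → Pauli1

/-- Pauli weight patterns: bit strings of length `m`. -/
abbrev Pattern (m : ℕ) := Fin m → ZMod 2

namespace Pauli

variable {m : ℕ}

/-- The matrix `P₁ ⊗ ⋯ ⊗ Pₘ` of a Pauli operator. -/
def toMatrix (P : Pauli m) : Op m := tensor fun j => (P j).toMatrix

/-- The identity Pauli operator. -/
def id : Pauli m := fun _ => Pauli1.I

/-- The inner product `⟨P, Q⟩`: `0` if `P` and `Q` commute, `1` otherwise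
(see `toMatrix_mul_toMatrix_comm`). -/
def inner (P Q : Pauli m) : ZMod 2 := ∑ j, (P j).inner (Q j)

/-- The sign `(-1)^⟨P, Q⟩`. -/
def sign (P Q : Pauli m) : ℝ := (-1) ^ (inner P Q).val

/-- The Pauli weight pattern: bit `j` is `0` iff `P` acts as the identity on qubit `j`. -/
def pattern (P : Pauli m) : Pattern m := fun j => if P j = Pauli1.I then 0 else 1

end Pauli

/-! ### Basic facts -/

theorem tensor_mul {m : ℕ} (A B : Fin m → Matrix (Fin 2) (Fin 2) ℂ) :
    tensor A * tensor B = tensor fun j => A j * B j := by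
  ext a b
  simp only [tensor, Matrix.mul_apply, Matrix.of_apply, ← Finset.prod_mul_distrib]
  rw [Finset.prod_univ_sum]
  simp [Fintype.piFinset_univ]

theorem trace_tensor {m : ℕ} (A : Fin m → Matrix (Fin 2) (Fin 2) ℂ) :
    (tensor A).trace = ∏ j, (A j).trace := by
  simp only [tensor, Matrix.trace, Matrix.diag_apply, Matrix.of_apply]
  rw [Finset.prod_univ_sum]
  simp [Fintype.piFinset_univ]

theorem Pauli1.toMatrix_mul_comm (P Q : Pauli1) :
    P.toMatrix * Q.toMatrix = ((-1 : ℂ) ^ (P.inner Q).val) • (Q.toMatrix * P.toMatrix) := by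
  have h1 : (1 : ZMod 2).val = 1 := rfl
  cases P <;> cases Q <;> ext i j <;> fin_cases i <;> fin_cases j <;>
    simp [Pauli1.toMatrix, Pauli1.inner, h1]

theorem neg_one_pow_val_add (a b : ZMod 2) :
    ((-1 : ℂ) ^ (a + b).val) = (-1) ^ a.val * (-1) ^ b.val := by
  rw [← pow_add, ZMod.val_add, ← neg_one_pow_eq_pow_mod_two]

theorem neg_one_pow_val_sum {κ : Type*} (s : Finset κ) (f : κ → ZMod 2) :
    ((-1 : ℂ) ^ (∑ j ∈ s, f j).val) = ∏ j ∈ s, (-1) ^ (f j).val := by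
  classical
  induction s using Finset.induction_on with
  | empty => simp
  | insert a s ha ih => rw [Finset.sum_insert ha, Finset.prod_insert ha, neg_one_pow_val_add, ih]

/-- `P Q = (-1)^⟨P, Q⟩ Q P`. -/
theorem Pauli.toMatrix_mul_toMatrix_comm {m : ℕ} (P Q : Pauli m) :
    P.toMatrix * Q.toMatrix = ((-1 : ℂ) ^ (P.inner Q).val) • (Q.toMatrix * P.toMatrix) := by
  simp only [Pauli.toMatrix, tensor_mul, Pauli.inner, neg_one_pow_val_sum]
  ext a b
  simp only [tensor, Matrix.of_apply, Matrix.smul_apply, smul_eq_mul, ← Finset.prod_mul_distrib]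
  refine Finset.prod_congr rfl fun j _ => ?_
  rw [Pauli1.toMatrix_mul_comm]
  simp

theorem Pauli1.trace_mul (P Q : Pauli1) :
    (P.toMatrix * Q.toMatrix).trace = if P = Q then 2 else 0 := by
  cases P <;> cases Q <;> simp [Pauli1.toMatrix, Matrix.trace_fin_two] <;> norm_num

theorem Pauli.trace_mul {m : ℕ} (P Q : Pauli m) :
    (P.toMatrix * Q.toMatrix).trace = if P = Q then 2 ^ m else 0 := by
  simp only [Pauli.toMatrix, tensor_mul, trace_tensor, Pauli1.trace_mul]
  split_ifs with h
  · simp [h]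
  · obtain ⟨j, hj⟩ := Function.ne_iff.mp h
    exact Finset.prod_eq_zero (Finset.mem_univ j) (by simp [hj])

/-! ## Clifford gates -/

/-- An `m`-qubit Clifford gate: a unitary that conjugates every Pauli operator to a Pauli operator
up to sign. -/
structure CliffordGate (m : ℕ) where
  U : Op m
  unitary : U ∈ Matrix.unitaryGroup (Fin m → Fin 2) ℂ
  conj_pauli : ∀ P : Pauli m, ∃ Q : Pauli m,
    U * P.toMatrix * Uᴴ = Q.toMatrix ∨ U * P.toMatrix * Uᴴ = -Q.toMatrix

namespace CliffordGate

variable {m : ℕ}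

/-- The channel `𝒢(ρ) = G ρ G†`. -/
def channel (G : CliffordGate m) (A : Op m) : Op m := G.U * A * G.Uᴴ

theorem exists_pullback (G : CliffordGate m) (Q : Pauli m) : ∃ R : Pauli m,
    G.Uᴴ * Q.toMatrix * G.U = R.toMatrix ∨ G.Uᴴ * Q.toMatrix * G.U = -R.toMatrix := by
  have h1 : G.Uᴴ * G.U = 1 := Matrix.mem_unitaryGroup_iff'.mp G.unitary
  choose f hf using G.conj_pauli
  have key : ∀ R, G.Uᴴ * (f R).toMatrix * G.U = R.toMatrix ∨
      G.Uᴴ * (f R).toMatrix * G.U = -R.toMatrix := by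
    intro R
    have h2 : G.Uᴴ * (G.U * R.toMatrix * G.Uᴴ) * G.U = R.toMatrix := by
      calc G.Uᴴ * (G.U * R.toMatrix * G.Uᴴ) * G.U
          = (G.Uᴴ * G.U) * R.toMatrix * (G.Uᴴ * G.U) := by simp only [Matrix.mul_assoc]
        _ = R.toMatrix := by rw [h1]; simp
    rcases hf R with h | h
    · left; rw [h] at h2; exact h2
    · right; rw [h] at h2; rw [← h2]; simp
  have hinj : Function.Injective f := by
    intro R S hRS
    by_contra hne
    have hz : (R.toMatrix * S.toMatrix).trace = 0 := by rw [Pauli.trace_mul]; simp [hne]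
    have hd : (R.toMatrix * R.toMatrix).trace = 2 ^ m := by rw [Pauli.trace_mul]; simp
    have h2 : (2 : ℂ) ^ m ≠ 0 := pow_ne_zero m two_ne_zero
    have hR := key R
    have hS := key S
    rw [hRS] at hR
    have : S.toMatrix = R.toMatrix ∨ S.toMatrix = -R.toMatrix := by
      rcases hR with hR | hR <;> rcases hS with hS | hS <;> rw [hR] at hS
      · left; exact hS.symm
      · right; rw [hS]; simp
      · right; exact hS.symm
      · left; exact (neg_injective hS).symm
    rcases this with h | h <;> rw [h] at hz
    · exact h2 (hd ▸ hz)
    · simp only [Matrix.mul_neg, Matrix.trace_neg, neg_eq_zero] at hz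
      exact h2 (hd ▸ hz)
  obtain ⟨R, rfl⟩ := Finite.surjective_of_injective hinj Q
  exact ⟨R, key R⟩

/-- The Pauli operator `𝒢†(Q) = G† Q G`, modulo phase. -/
noncomputable def pullback (G : CliffordGate m) (Q : Pauli m) : Pauli m :=
  Classical.choose (G.exists_pullback Q)

theorem pullback_spec (G : CliffordGate m) (Q : Pauli m) :
    G.Uᴴ * Q.toMatrix * G.U = (G.pullback Q).toMatrix ∨
      G.Uᴴ * Q.toMatrix * G.U = -(G.pullback Q).toMatrix :=
  Classical.choose_spec (G.exists_pullback Q)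

/-! ## The pattern transfer graph of a Clifford gate

Vertices are the Pauli weight patterns; for every Pauli operator `Q` there is one directed edge
`e^Q` from `pt(𝒢†(Q))` to `pt(Q)`.  Edges are identified with their labels `Q`. -/

/-- The starting vertex of the edge `e^Q`. -/
noncomputable def edgeSource (G : CliffordGate m) (Q : Pauli m) : Pattern m :=
  (G.pullback Q).pattern

/-- The end vertex of the edge `e^Q`. -/
def edgeTarget (_G : CliffordGate m) (Q : Pauli m) : Pattern m := Q.pattern

/-- `v₀, e^{Q₁}, v₁, …, e^{Q_l}, v_l` is a directed path with `v_l = v₀`. -/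
def IsCycle (G : CliffordGate m) {l : ℕ} (v : Fin (l + 1) → Pattern m) (Q : Fin l → Pauli m) :
    Prop :=
  (∀ k : Fin l, G.edgeSource (Q k) = v k.castSucc ∧ G.edgeTarget (Q k) = v k.succ) ∧
    v (Fin.last l) = v 0

/-- The boundary operator from `1`-chains to `0`-chains: `∂ e = (end of e) - (start of e)`. -/
noncomputable def boundary (G : CliffordGate m) : (Pauli m →₀ ℝ) →ₗ[ℝ] (Pattern m →₀ ℝ) :=
  Finsupp.linearCombination ℝ fun Q =>
    Finsupp.single (G.edgeTarget Q) 1 - Finsupp.single (G.edgeSource Q) 1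

/-- The cycle space: `1`-chains with zero boundary. -/
noncomputable def cycleSpace (G : CliffordGate m) : Submodule ℝ (Pauli m →₀ ℝ) :=
  LinearMap.ker G.boundary

end CliffordGate

/-- The Walsh–Hadamard transform on `1`-chains,
`e^Q ↦ 4^{-m} ∑_R (-1)^⟨Q, R⟩ e^R`. -/
noncomputable def walshHadamard (m : ℕ) : (Pauli m →₀ ℝ) →ₗ[ℝ] (Pauli m →₀ ℝ) :=
  Finsupp.linearCombination ℝ fun Q =>
    ((4 : ℝ) ^ m)⁻¹ • ∑ R : Pauli m, Finsupp.single R (Q.sign R)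

/-! ## Pauli channels -/

/-- The Pauli fidelities `λ^Q = ∑_P (-1)^⟨P, Q⟩ p^P` of the Pauli error rates `p`. -/
noncomputable def pauliFidelity {m : ℕ} (p : Pauli m → ℝ) (Q : Pauli m) : ℝ :=
  ∑ P : Pauli m, P.sign Q * p P

/-- A Pauli channel `∑_P p^P 𝒫` with positive Pauli fidelities which is not on the boundary of the
polytope of completely positive maps, i.e. all of whose error rates are positive. -/
structure PauliNoise (m : ℕ) where
  /-- the Pauli error rates `p^P` -/
  rate : Pauli m → ℝ
  rate_pos : ∀ P, 0 < rate P
  sum_rate : ∑ P, rate P = 1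
  fidelity_pos : ∀ Q, 0 < pauliFidelity rate Q

namespace PauliNoise

variable {m : ℕ}

/-- The action of the channel on operators. -/
noncomputable def channel (Λ : PauliNoise m) (A : Op m) : Op m :=
  ∑ P : Pauli m, (Λ.rate P : ℂ) • (P.toMatrix * A * P.toMatrixᴴ)

/-- The Pauli fidelities of the channel. -/
noncomputable def fidelity (Λ : PauliNoise m) (Q : Pauli m) : ℝ := pauliFidelity Λ.rate Q

/-- The total error probability `1 - p^I`. -/
def errorProb (Λ : PauliNoise m) : ℝ := 1 - Λ.rate Pauli.id

/-- The first-order expression for the Pauli error rate `p^P`, obtained from the inversion formula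
`p^P = 4^{-m} ∑_Q (-1)^⟨P, Q⟩ λ^Q` by replacing `λ^Q` with `1 + log λ^Q`:
`4^{-m} ∑_Q (-1)^⟨P, Q⟩ log λ^Q + δ_{P, I}`. -/
noncomputable def firstOrderRate (Λ : PauliNoise m) (P : Pauli m) : ℝ :=
  ((4 : ℝ) ^ m)⁻¹ * (∑ Q : Pauli m, P.sign Q * Real.log (Λ.fidelity Q)) +
    if P = Pauli.id then 1 else 0

end PauliNoise

/-! ## Noise models, experiments, learnability -/

/-- A noise model for the gate set `(G i)_i` on `m` qubits: an unknown initial state, an unknown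
Pauli channel after each gate, and an unknown symmetric Pauli channel before the terminating
measurement. -/
structure NoiseModel {m : ℕ} {ι : Type*} (G : ι → CliffordGate m) where
  /-- the initial state -/
  ρ : Op m
  ρ_posSemidef : ρ.PosSemidef
  ρ_trace : ρ.trace = 1
  /-- the initial state overlaps with some Pauli operator of every pattern -/
  ρ_overlap : ∀ v : Pattern m, ∃ P : Pauli m, P.pattern = v ∧ (P.toMatrix * ρ).trace ≠ 0
  /-- the Pauli noise following each gate -/
  gateNoise : ι → PauliNoise m
  /-- the Pauli noise preceding the terminating measurement -/
  measNoise : PauliNoise m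
  measNoise_symm : ∀ P Q : Pauli m, P.pattern = Q.pattern →
    measNoise.fidelity P = measNoise.fidelity Q

/-- A circuit layer: noiseless single-qubit unitaries on all qubits, or one of the noisy gates. -/
inductive Layer (m : ℕ) (ι : Type*) where
  | single (V : Fin m → Matrix.unitaryGroup (Fin 2) ℂ)
  | gate (i : ι)

/-- An experiment: a sequence of layers (the head of the list is applied first), followed by a
terminating measurement of an arbitrary POVM. -/
structure Experiment (m : ℕ) (ι : Type*) where
  layers : List (Layer m ι)
  /-- the number of outcomes -/
  outcomes : ℕ
  povm : Fin outcomes → Op m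
  povm_posSemidef : ∀ j, (povm j).PosSemidef
  sum_povm : ∑ j, povm j = 1

namespace NoiseModel

variable {m : ℕ} {ι : Type*} {G : ι → CliffordGate m}

/-- The physical action of a layer on an operator; a noisy gate is `Λ_i ∘ 𝒢_i`. -/
noncomputable def applyLayer (N : NoiseModel G) (A : Op m) : Layer m ι → Op m
  | .single V => tensor (fun j => (V j : Matrix (Fin 2) (Fin 2) ℂ)) * A *
      (tensor fun j => (V j : Matrix (Fin 2) (Fin 2) ℂ))ᴴ
  | .gate i => (N.gateNoise i).channel ((G i).channel A)

/-- The probability of outcome `j` in an experiment. -/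
noncomputable def prob (N : NoiseModel G) (e : Experiment m ι) (j : Fin e.outcomes) : ℝ :=
  (e.povm j * N.measNoise.channel (e.layers.foldl N.applyLayer N.ρ)).trace.re

/-- Two noise models are indistinguishable if all experiments have the same outcome distribution. -/
def Indistinguishable (N₁ N₂ : NoiseModel G) : Prop :=
  ∀ (e : Experiment m ι) (j : Fin e.outcomes), N₁.prob e j = N₂.prob e j

end NoiseModel

/-- A function of the noise model is learnable if it agrees on indistinguishable noise models. -/
def Learnable {m : ℕ} {ι : Type*} {G : ι → CliffordGate m} (f : NoiseModel G → ℝ) : Prop :=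
  ∀ N₁ N₂ : NoiseModel G, N₁.Indistinguishable N₂ → f N₁ = f N₂

/-- `f` agrees with `F` to first order in the error probability of gate `i`. -/
def EqToFirstOrder {m : ℕ} {ι : Type*} {G : ι → CliffordGate m} (i : ι)
    (F f : NoiseModel G → ℝ) : Prop :=
  ∃ C ε : ℝ, 0 < ε ∧ ∀ N : NoiseModel G, (N.gateNoise i).errorProb ≤ ε →
    |F N - f N| ≤ C * (N.gateNoise i).errorProb ^ 2

end PauliLearning

open PauliLearning

namespace PauliLearning

/-! ## Algebra of Pauli operators -/

/-! Cycles are the chains orthogonal to all coboundaries `φ(target) - φ(source)` of functions `φ` of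
patterns. The Walsh–Hadamard transform is symmetric and sends a function of the pattern to another
one, since permuting `X, Y, Z` on each qubit preserves signs. Conjugation by a Clifford gate also
preserves signs, so the same transformed function serves sources and targets. Coboundaries thus go
to coboundaries, hence cycles to cycles; surjectivity holds because the transform squares to
`4^{-m}`.

For learnability, comparing a Pauli expectation after one noisy gate with one taken directly on the
initial state cancels the state. Between indistinguishable models, the change in log-fidelity is
then the coboundary of a potential built from the measurement fidelities (`exists_potential`), so
every cycle pairs to zero with it. Up to a constant, the sum of first-order rates along a closed
walk pairs the transform of the walk with the log-fidelities, and that transform is again a cycle.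
The error estimate comes from `λ - 1 - log λ = O((λ - 1)²)`. -/

theorem tensor_one {m : ℕ} : tensor (fun _ : Fin m => (1 : Matrix (Fin 2) (Fin 2) ℂ)) = 1 := by
  ext a b
  simp only [tensor, Matrix.of_apply, Matrix.one_apply, Finset.prod_ite_zero, Finset.prod_const_one,
    Finset.mem_univ, true_implies, funext_iff]

theorem conjTranspose_tensor {m : ℕ} (A : Fin m → Matrix (Fin 2) (Fin 2) ℂ) :
    (tensor A)ᴴ = tensor fun j => (A j)ᴴ := by
  ext a b
  simp [tensor, Matrix.conjTranspose_apply]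

namespace Pauli1

/-- The sign `(-1)^⟨P, Q⟩` for a single qubit. -/
def sign (P Q : Pauli1) : ℝ := (-1) ^ (P.inner Q).val

theorem univ_eq : (Finset.univ : Finset Pauli1) = {.I, .X, .Y, .Z} := rfl

theorem sum_sign_mul_sign (A B : Pauli1) :
    ∑ Q : Pauli1, A.sign Q * B.sign Q = if A = B then 4 else 0 := by
  have h1 : (1 : ZMod 2).val = 1 := rfl
  cases A <;> cases B <;> simp [univ_eq, sign, inner, h1] <;> norm_num

theorem inner_comm (P Q : Pauli1) : P.inner Q = Q.inner P := by
  cases P <;> cases Q <;> rfl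

theorem conjTranspose_toMatrix (P : Pauli1) : P.toMatrixᴴ = P.toMatrix := by
  cases P <;> ext i j <;> fin_cases i <;> fin_cases j <;>
    simp [toMatrix, Matrix.conjTranspose_apply]

theorem toMatrix_mul_self (P : Pauli1) : P.toMatrix * P.toMatrix = 1 := by
  cases P <;> ext i j <;> fin_cases i <;> fin_cases j <;> simp [toMatrix]

/-- Any two non-identity single-qubit Pauli operators are unitarily conjugate. -/
theorem exists_unitary_conj (A B : Pauli1) (h : A = I ↔ B = I) :
    ∃ V : Matrix.unitaryGroup (Fin 2) ℂ,
      (V : Matrix (Fin 2) (Fin 2) ℂ)ᴴ * A.toMatrix * V = B.toMatrix := by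
  rcases eq_or_ne A B with rfl | hAB
  · exact ⟨1, by simp⟩
  have hA : A ≠ I := fun hA => hAB (hA.trans (h.mp hA).symm)
  have hB : B ≠ I := fun hB => hA (h.mpr hB)
  have hanti : B.toMatrix * A.toMatrix = -(A.toMatrix * B.toMatrix) := by
    have h1 : (1 : ZMod 2).val = 1 := rfl
    rw [toMatrix_mul_comm, inner, if_neg (by tauto), h1]
    simp
  have hAA := A.toMatrix_mul_self
  have hBB := B.toMatrix_mul_self
  -- The conjugator is `(A + B)/√2`: for anticommuting self-adjoint involutions it is a self-adjoint
  -- unitary exchanging `A` and `B`.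
  set c : ℂ := ((√2 : ℝ) : ℂ)⁻¹ with hc
  have hcc : c * c = 2⁻¹ := by
    rw [hc, ← mul_inv, ← Complex.ofReal_mul, Real.mul_self_sqrt (by norm_num)]
    simp
  have hstar : (c • (A.toMatrix + B.toMatrix))ᴴ = c • (A.toMatrix + B.toMatrix) := by
    rw [Matrix.conjTranspose_smul, Matrix.conjTranspose_add, conjTranspose_toMatrix,
      conjTranspose_toMatrix, hc, star_inv₀]
    simp
  have hsq : (A.toMatrix + B.toMatrix) * (A.toMatrix + B.toMatrix) = (2 : ℂ) • 1 := by
    rw [add_mul, mul_add, mul_add, hAA, hBB, hanti, two_smul]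
    abel
  have hconj : (A.toMatrix + B.toMatrix) * A.toMatrix * (A.toMatrix + B.toMatrix)
      = (2 : ℂ) • B.toMatrix := by
    rw [add_mul, hAA, hanti, add_mul, mul_add, neg_mul, Matrix.mul_assoc, mul_add, mul_add, hBB,
      hanti, mul_neg, ← Matrix.mul_assoc, hAA, two_smul]
    simp only [Matrix.mul_one, Matrix.one_mul]
    abel
  refine ⟨⟨c • (A.toMatrix + B.toMatrix), ?_⟩, ?_⟩
  · rw [Matrix.mem_unitaryGroup_iff', Matrix.star_eq_conjTranspose, hstar, smul_mul_smul_comm, hsq,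
      hcc, smul_smul]
    simp
  · change (c • (A.toMatrix + B.toMatrix))ᴴ * A.toMatrix * (c • (A.toMatrix + B.toMatrix)) = _
    rw [hstar, smul_mul_assoc, smul_mul_smul_comm, hconj, hcc, smul_smul]
    simp

end Pauli1

namespace Pauli

variable {m : ℕ}

theorem sign_eq_prod (P Q : Pauli m) : P.sign Q = ∏ j, (P j).sign (Q j) := by
  apply Complex.ofReal_injective
  simp only [sign, Pauli1.sign, inner, Complex.ofReal_prod, Complex.ofReal_pow, Complex.ofReal_neg,
    Complex.ofReal_one]
  exact neg_one_pow_val_sum _ _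

theorem sign_comm (P Q : Pauli m) : P.sign Q = Q.sign P := by
  simp only [sign, inner, Pauli1.inner_comm]

theorem abs_sign (P Q : Pauli m) : |P.sign Q| = 1 := by
  simp [sign, abs_pow]

theorem sign_id_left (Q : Pauli m) : sign id Q = 1 := by
  simp [sign, inner, id, Pauli1.inner]

theorem sum_sign_mul_sign (A B : Pauli m) :
    ∑ Q : Pauli m, A.sign Q * B.sign Q = if A = B then (4 : ℝ) ^ m else 0 := by
  simp only [sign_eq_prod, ← Finset.prod_mul_distrib]
  have := Finset.prod_univ_sum (fun _ : Fin m => (Finset.univ : Finset Pauli1))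
    (fun j q => (A j).sign q * (B j).sign q)
  rw [Fintype.piFinset_univ] at this
  rw [← this]
  simp only [Pauli1.sum_sign_mul_sign]
  split_ifs with h
  · simp [h]
  · obtain ⟨j, hj⟩ := Function.ne_iff.mp h
    exact Finset.prod_eq_zero (Finset.mem_univ j) (by simp [hj])

theorem sum_sign (A : Pauli m) :
    ∑ Q : Pauli m, A.sign Q = if A = id then (4 : ℝ) ^ m else 0 := by
  simpa [sign_id_left] using sum_sign_mul_sign A id

theorem pattern_eq_iff (P Q : Pauli m) :
    P.pattern = Q.pattern ↔ ∀ j, P j = Pauli1.I ↔ Q j = Pauli1.I := by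
  simp only [pattern, funext_iff]
  refine forall_congr' fun j => ?_
  by_cases h1 : P j = Pauli1.I <;> by_cases h2 : Q j = Pauli1.I <;> simp [h1, h2]

/-- Summing a function of the pattern against the characters gives a function of the pattern. -/
theorem sum_sign_mul_pattern_congr (φ : Pattern m → ℝ) {Q Q' : Pauli m}
    (h : Q.pattern = Q'.pattern) :
    ∑ R : Pauli m, Q.sign R * φ R.pattern = ∑ R : Pauli m, Q'.sign R * φ R.pattern := by
  rw [pattern_eq_iff] at h
  -- Equal patterns make each swap fix `I`, so relabelling `R` by the swaps keeps its pattern.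
  have hI : ∀ j P, Equiv.swap (Q j) (Q' j) P = Pauli1.I ↔ P = Pauli1.I := by
    intro j P
    have hfix : Equiv.swap (Q j) (Q' j) Pauli1.I = Pauli1.I := by
      by_cases hj : Q j = Pauli1.I
      · rw [hj, (h j).mp hj, Equiv.swap_self, Equiv.refl_apply]
      · exact Equiv.swap_apply_of_ne_of_ne (Ne.symm hj) fun hj' => hj ((h j).mpr hj'.symm)
    conv_lhs => rw [← hfix]
    exact (Equiv.swap (Q j) (Q' j)).injective.eq_iff
  refine Fintype.sum_equiv (Equiv.piCongrRight fun j => Equiv.swap (Q j) (Q' j)) _ _ fun R => ?_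
  congr 1
  · simp only [sign, inner]
    congr 2
    refine Finset.sum_congr rfl fun j _ => ?_
    have hs : Q' j = Equiv.swap (Q j) (Q' j) (Q j) := (Equiv.swap_apply_left _ _).symm
    -- The single-qubit inner product sees only which labels are `I` and whether they agree; the
    -- swap preserves both.
    simp only [Pauli1.inner, Equiv.piCongrRight_apply, Pi.map_apply, hI, ← h j]
    have : Q' j = Equiv.swap (Q j) (Q' j) (R j) ↔ Q j = R j := by
      conv_lhs => lhs; rw [hs]
      exact (Equiv.swap (Q j) (Q' j)).injective.eq_iff
    simp only [this]
  · congr 1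
    rw [pattern_eq_iff]
    exact fun j => (hI j (R j)).symm

theorem conjTranspose_toMatrix (P : Pauli m) : P.toMatrixᴴ = P.toMatrix := by
  simp only [toMatrix, conjTranspose_tensor, Pauli1.conjTranspose_toMatrix]

theorem toMatrix_mul_self (P : Pauli m) : P.toMatrix * P.toMatrix = 1 := by
  simp only [toMatrix, tensor_mul, Pauli1.toMatrix_mul_self, tensor_one]

theorem toMatrix_mul_comm_sign (P Q : Pauli m) :
    P.toMatrix * Q.toMatrix = (P.sign Q : ℂ) • (Q.toMatrix * P.toMatrix) := by
  rw [toMatrix_mul_toMatrix_comm, sign]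
  push_cast
  rfl

theorem toMatrix_mul_ne_zero (P Q : Pauli m) : P.toMatrix * Q.toMatrix ≠ 0 := by
  intro h
  have : P.toMatrix * Q.toMatrix * (Q.toMatrix * P.toMatrix) = 1 := by
    rw [Matrix.mul_assoc, ← Matrix.mul_assoc Q.toMatrix, toMatrix_mul_self, Matrix.one_mul,
      toMatrix_mul_self]
  rw [h, Matrix.zero_mul] at this
  exact zero_ne_one this

/-- Pauli operators with the same pattern are conjugate under single-qubit unitaries. -/
theorem exists_unitary_conj {P Q : Pauli m} (h : P.pattern = Q.pattern) :
    ∃ V : Fin m → Matrix.unitaryGroup (Fin 2) ℂ,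
      (tensor fun j => (V j : Matrix (Fin 2) (Fin 2) ℂ))ᴴ * P.toMatrix *
        (tensor fun j => (V j : Matrix (Fin 2) (Fin 2) ℂ)) = Q.toMatrix := by
  choose V hV using fun j => Pauli1.exists_unitary_conj (P j) (Q j) ((pattern_eq_iff P Q).mp h j)
  refine ⟨V, ?_⟩
  simp only [conjTranspose_tensor, toMatrix, tensor_mul, hV]

/-- `(1 + A)/2` is an orthogonal projection, hence of the form `BᴴB`. -/
theorem half_one_add_posSemidef {A : Op m} (hA : Aᴴ = A) (hAA : A * A = 1) :
    ((2⁻¹ : ℂ) • (1 + A)).PosSemidef := by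
  have h : (2⁻¹ : ℂ) • (1 + A) = ((2⁻¹ : ℂ) • (1 + A))ᴴ * ((2⁻¹ : ℂ) • (1 + A)) := by
    rw [Matrix.conjTranspose_smul, Matrix.conjTranspose_add, hA, Matrix.conjTranspose_one,
      smul_mul_smul_comm, add_mul, mul_add, mul_add, hAA, Matrix.one_mul, Matrix.one_mul,
      Matrix.mul_one, add_comm A 1, ← two_smul ℂ, smul_smul]
    congr 1
    simp
  rw [h]
  exact Matrix.posSemidef_conjTranspose_mul_self _

theorem trace_mul_im_eq_zero (P : Pauli m) {ρ : Op m} (hρ : ρ.IsHermitian) :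
    (P.toMatrix * ρ).trace.im = 0 := by
  have h : star (P.toMatrix * ρ).trace = (P.toMatrix * ρ).trace := by
    rw [← Matrix.trace_conjTranspose, Matrix.conjTranspose_mul, hρ.eq, conjTranspose_toMatrix,
      Matrix.trace_mul_comm]
  exact Complex.conj_eq_iff_im.mp h

end Pauli

/-! ## The Walsh–Hadamard transform and the cycle space -/

namespace CliffordGate

variable {m : ℕ} (G : CliffordGate m)

theorem U_mul_conjTranspose : G.U * G.Uᴴ = 1 := Matrix.mem_unitaryGroup_iff.mp G.unitary

theorem pullback_spec_sign (Q : Pauli m) : ∃ s : ℝ, s ≠ 0 ∧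
    G.Uᴴ * Q.toMatrix * G.U = (s : ℂ) • (G.pullback Q).toMatrix := by
  rcases G.pullback_spec Q with h | h
  · exact ⟨1, one_ne_zero, by simpa using h⟩
  · exact ⟨-1, by norm_num, by simpa using h⟩

theorem conjTranspose_conj_mul (A B : Op m) :
    (G.Uᴴ * A * G.U) * (G.Uᴴ * B * G.U) = G.Uᴴ * (A * B) * G.U := by
  calc (G.Uᴴ * A * G.U) * (G.Uᴴ * B * G.U) = G.Uᴴ * A * (G.U * G.Uᴴ) * B * G.U := by
        simp only [Matrix.mul_assoc]
    _ = G.Uᴴ * (A * B) * G.U := by 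
        rw [U_mul_conjTranspose]
        simp only [Matrix.mul_one, Matrix.mul_assoc]

/-- Unitary conjugation preserves commutation relations, and the phases lost in `pullback` occur on
both sides and cancel. -/
theorem pullback_sign (P Q : Pauli m) : (G.pullback P).sign (G.pullback Q) = P.sign Q := by
  obtain ⟨s, hs, hP⟩ := G.pullback_spec_sign P
  obtain ⟨t, ht, hQ⟩ := G.pullback_spec_sign Q
  have h1 := G.conjTranspose_conj_mul P.toMatrix Q.toMatrix
  have h2 := G.conjTranspose_conj_mul Q.toMatrix P.toMatrix
  rw [P.toMatrix_mul_comm_sign, Matrix.mul_smul, Matrix.smul_mul, ← h2, hP, hQ, smul_mul_smul_comm,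
    smul_mul_smul_comm, Pauli.toMatrix_mul_comm_sign, smul_smul, smul_smul] at h1
  have h3 := smul_left_injective ℂ (Pauli.toMatrix_mul_ne_zero _ _) h1
  have hst : (s : ℂ) * t ≠ 0 := by simp [hs, ht]
  have h4 : (s : ℂ) * t * ((G.pullback P).sign (G.pullback Q)) = s * t * (P.sign Q) := by
    rw [h3]; ring
  exact_mod_cast mul_left_cancel₀ hst h4

/-- Equal pullbacks force equal characters `R ↦ (-1)^⟨P, R⟩`, contradicting orthogonality. -/
theorem pullback_injective : Function.Injective G.pullback := by
  intro P Q h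
  by_contra hne
  have h1 := Pauli.sum_sign_mul_sign P Q
  have h2 := Pauli.sum_sign_mul_sign P P
  have h3 : ∀ R, P.sign R = Q.sign R := fun R => by
    rw [← G.pullback_sign, h, G.pullback_sign]
  rw [if_neg hne] at h1
  simp only [h3, if_true] at h1 h2
  rw [h1] at h2
  exact pow_ne_zero m four_ne_zero h2.symm

/-- Pairing `φ` with the boundary of `z` is pairing `z` with the coboundary of `φ`; indicators of
vertices detect a zero boundary. -/
theorem mem_cycleSpace_iff (z : Pauli m →₀ ℝ) : z ∈ G.cycleSpace ↔
    ∀ φ : Pattern m → ℝ, ∑ Q, z Q * (φ (G.edgeTarget Q) - φ (G.edgeSource Q)) = 0 := by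
  have key : ∀ φ : Pattern m → ℝ, Finsupp.linearCombination ℝ φ (G.boundary z) =
      ∑ Q, z Q * (φ (G.edgeTarget Q) - φ (G.edgeSource Q)) := by
    intro φ
    rw [boundary, Finsupp.linearCombination_apply ℝ z, Finsupp.sum_fintype _ _ (by simp), map_sum]
    simp [Finsupp.linearCombination_single]
  rw [cycleSpace, LinearMap.mem_ker]
  constructor
  · intro h φ
    rw [← key, h, map_zero]
  · intro h
    ext v
    have := h (Pi.single v 1)
    rw [← key, Finsupp.linearCombination_apply, Finsupp.sum_fintype _ _ (by simp)] at this
    simpa [Pi.single_apply] using this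

theorem IsCycle.sum_single_mem_cycleSpace {G : CliffordGate m} {l : ℕ}
    {v : Fin (l + 1) → Pattern m} {Q : Fin l → Pauli m} (h : G.IsCycle v Q) :
    ∑ k, Finsupp.single (Q k) (1 : ℝ) ∈ G.cycleSpace := by
  rw [mem_cycleSpace_iff]
  intro φ
  have h1 : ∀ R : Pauli m, (∑ k, Finsupp.single (Q k) (1 : ℝ)) R
      = ∑ k, if Q k = R then (1 : ℝ) else 0 := by
    intro R
    simp [Finsupp.finsetSum_apply, Finsupp.single_apply]
  simp only [h1, Finset.sum_mul]
  rw [Finset.sum_comm]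
  simp only [ite_mul, one_mul, zero_mul, Finset.sum_ite_eq, Finset.mem_univ, if_true, (h.1 _).1,
    (h.1 _).2, Finset.sum_sub_distrib]
  -- The potential telescopes around the closed walk.
  have h2 := Fin.sum_univ_succ fun k => φ (v k)
  rw [Fin.sum_univ_castSucc, h.2] at h2
  linarith

end CliffordGate

section WalshHadamard

variable {m : ℕ}

theorem walshHadamard_apply (z : Pauli m →₀ ℝ) (R : Pauli m) :
    walshHadamard m z R = ((4 : ℝ) ^ m)⁻¹ * ∑ Q, z Q * Q.sign R := by
  rw [walshHadamard, Finsupp.linearCombination_apply, Finsupp.sum_fintype _ _ (by simp),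
    Finset.mul_sum]
  simp only [Finsupp.finsetSum_apply, Finsupp.smul_apply, Finsupp.single_apply, smul_eq_mul,
    Finset.sum_ite_eq', Finset.mem_univ, if_true]
  exact Finset.sum_congr rfl fun _ _ => by ring

theorem sum_walshHadamard_mul (z : Pauli m →₀ ℝ) (f : Pauli m → ℝ) :
    ∑ R, walshHadamard m z R * f R = ((4 : ℝ) ^ m)⁻¹ * ∑ Q, z Q * ∑ R, Q.sign R * f R := by
  simp only [walshHadamard_apply, Finset.mul_sum, Finset.sum_mul]
  rw [Finset.sum_comm]
  exact Finset.sum_congr rfl fun _ _ => Finset.sum_congr rfl fun _ _ => by ring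

theorem walshHadamard_walshHadamard (z : Pauli m →₀ ℝ) :
    walshHadamard m (walshHadamard m z) = ((4 : ℝ) ^ m)⁻¹ • z := by
  ext R
  rw [walshHadamard_apply, sum_walshHadamard_mul]
  have h4 : (4 : ℝ) ^ m ≠ 0 := pow_ne_zero m four_ne_zero
  have : ∀ Q : Pauli m, ∑ S : Pauli m, Q.sign S * S.sign R = if Q = R then (4 : ℝ) ^ m else 0 := by
    intro Q
    simp only [Pauli.sign_comm _ R, Pauli.sum_sign_mul_sign]
  simp [this, h4, mul_comm]

theorem walshHadamard_mem_cycleSpace (G : CliffordGate m) {z : Pauli m →₀ ℝ}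
    (hz : z ∈ G.cycleSpace) : walshHadamard m z ∈ G.cycleSpace := by
  rw [CliffordGate.mem_cycleSpace_iff] at hz ⊢
  intro φ
  -- `ψ` is the unnormalised transform of `φ`, descended to patterns; the default `0` is never used,
  -- as `ψ` is only evaluated at patterns of Pauli operators.
  obtain ⟨ψ, hψ⟩ : ∃ ψ : Pattern m → ℝ, ∀ Q : Pauli m,
      ∑ R : Pauli m, Q.sign R * φ R.pattern = ψ Q.pattern :=
    ⟨Function.extend Pauli.pattern (fun Q : Pauli m => ∑ R : Pauli m, Q.sign R * φ R.pattern) 0,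
      fun Q => (Function.FactorsThrough.extend_apply (f := Pauli.pattern)
        (g := fun Q : Pauli m => ∑ R : Pauli m, Q.sign R * φ R.pattern)
        (fun _ _ h => Pauli.sum_sign_mul_pattern_congr φ h) 0 Q).symm⟩
  have hsource : ∀ Q : Pauli m, ∑ R : Pauli m, Q.sign R * φ (G.edgeSource R)
      = ψ (G.edgeSource Q) := by
    intro Q
    rw [CliffordGate.edgeSource, ← hψ]
    -- `pullback` is a sign-preserving permutation, so summing over sources gives the same `ψ`.
    refine Fintype.sum_bijective G.pullback
      (Finite.injective_iff_bijective.mp G.pullback_injective) _ _ fun R => ?_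
    rw [G.pullback_sign, CliffordGate.edgeSource]
  rw [sum_walshHadamard_mul]
  simp only [mul_sub, Finset.sum_sub_distrib, hsource, CliffordGate.edgeTarget, hψ]
  have := hz ψ
  simp only [mul_sub, Finset.sum_sub_distrib, CliffordGate.edgeTarget] at this
  rw [← mul_sub, this, mul_zero]

theorem map_walshHadamard_cycleSpace (G : CliffordGate m) :
    G.cycleSpace.map (walshHadamard m) = G.cycleSpace := by
  apply le_antisymm
  · rintro _ ⟨z, hz, rfl⟩
    exact walshHadamard_mem_cycleSpace G hz
  · intro z hz
    refine ⟨(4 : ℝ) ^ m • walshHadamard m z,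
      Submodule.smul_mem _ _ (walshHadamard_mem_cycleSpace G hz), ?_⟩
    rw [map_smul, walshHadamard_walshHadamard, smul_smul,
      mul_inv_cancel₀ (pow_ne_zero m four_ne_zero), one_smul]

end WalshHadamard

/-! ## First-order expansion of the Pauli error rates -/

namespace PauliNoise

variable {m : ℕ} (Λ : PauliNoise m)

theorem rate_eq (P : Pauli m) :
    Λ.rate P = ((4 : ℝ) ^ m)⁻¹ * ∑ Q : Pauli m, P.sign Q * Λ.fidelity Q := by
  have h4 : (4 : ℝ) ^ m ≠ 0 := pow_ne_zero m four_ne_zero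
  simp only [fidelity, pauliFidelity, Finset.mul_sum]
  rw [Finset.sum_comm]
  have : ∀ R : Pauli m, ∑ Q : Pauli m, ((4 : ℝ) ^ m)⁻¹ * (P.sign Q * (R.sign Q * Λ.rate R))
      = if P = R then Λ.rate R else 0 := by
    intro R
    have h := Pauli.sum_sign_mul_sign P R
    calc _ = ((4 : ℝ) ^ m)⁻¹ * (∑ Q : Pauli m, P.sign Q * R.sign Q) * Λ.rate R := by
          rw [Finset.mul_sum, Finset.sum_mul]
          exact Finset.sum_congr rfl fun _ _ => by ring
      _ = _ := by rw [h]; split_ifs <;> simp [h4]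
  simp [this]

/-- Only non-identity errors contribute, each with a factor `sign - 1` of size at most `2`. -/
theorem abs_fidelity_sub_one_le (Q : Pauli m) : |Λ.fidelity Q - 1| ≤ 2 * Λ.errorProb := by
  have h1 : ∑ P ∈ Finset.univ.erase Pauli.id, Λ.rate P = Λ.errorProb := by
    rw [errorProb, ← Λ.sum_rate, ← Finset.add_sum_erase _ _ (Finset.mem_univ Pauli.id)]
    ring
  have h2 : Λ.fidelity Q - 1 = ∑ P ∈ Finset.univ.erase Pauli.id, (P.sign Q - 1) * Λ.rate P := by
    simp only [sub_one_mul]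
    rw [fidelity, pauliFidelity, ← Λ.sum_rate, ← Finset.sum_sub_distrib,
      ← Finset.add_sum_erase _ _ (Finset.mem_univ Pauli.id), Pauli.sign_id_left, one_mul, sub_self,
      zero_add]
  rw [h2, ← h1, Finset.mul_sum]
  refine (Finset.abs_sum_le_sum_abs _ _).trans (Finset.sum_le_sum fun P _ => ?_)
  rw [abs_mul, abs_of_pos (Λ.rate_pos P)]
  refine mul_le_mul_of_nonneg_right ?_ (Λ.rate_pos P).le
  have := abs_le.mp (P.abs_sign Q).le
  rw [abs_le]
  constructor <;> linarith

theorem abs_sub_one_sub_log_le {x : ℝ} (hx : 1 / 2 ≤ x) :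
    |x - 1 - Real.log x| ≤ 2 * (x - 1) ^ 2 := by
  have hx0 : 0 < x := by linarith
  have h1 := Real.log_le_sub_one_of_pos hx0
  have h2 := Real.one_sub_inv_le_log_of_pos hx0
  rw [abs_of_nonneg (by linarith)]
  -- The left side is the gap between the bounds `x - 1` and `1 - 1/x` on `log x`.
  have h3 : x - 2 + x⁻¹ = (x - 1) ^ 2 * x⁻¹ := by field_simp; ring
  have h4 : x⁻¹ ≤ 2 := by
    rw [inv_le_comm₀ hx0 two_pos]; linarith
  nlinarith [mul_le_mul_of_nonneg_left h4 (sq_nonneg (x - 1))]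

theorem rate_sub_firstOrderRate (P : Pauli m) : Λ.rate P - Λ.firstOrderRate P =
    ((4 : ℝ) ^ m)⁻¹ *
      ∑ Q : Pauli m, P.sign Q * (Λ.fidelity Q - 1 - Real.log (Λ.fidelity Q)) := by
  have h4 : (4 : ℝ) ^ m ≠ 0 := pow_ne_zero m four_ne_zero
  have h : (if P = Pauli.id then (1 : ℝ) else 0) = ((4 : ℝ) ^ m)⁻¹ * ∑ Q : Pauli m, P.sign Q := by
    rw [Pauli.sum_sign]
    split_ifs <;> simp [h4]
  rw [rate_eq, firstOrderRate, h]
  simp only [mul_sub, mul_one, Finset.sum_sub_distrib]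
  ring

/-- The error is a signed average over `4^m` terms, so the bound is free of `m`. The threshold `1/4`
keeps fidelities above `1/2`, and `8 = 2 · 2²`. -/
theorem abs_rate_sub_firstOrderRate_le (hΛ : Λ.errorProb ≤ 1 / 4) (P : Pauli m) :
    |Λ.rate P - Λ.firstOrderRate P| ≤ 8 * Λ.errorProb ^ 2 := by
  have h4 : (0 : ℝ) < 4 ^ m := by positivity
  rw [rate_sub_firstOrderRate, abs_mul, abs_of_pos (inv_pos.mpr h4), inv_mul_le_iff₀ h4]
  refine (Finset.abs_sum_le_sum_abs _ _).trans ?_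
  have hterm : ∀ Q : Pauli m, |P.sign Q * (Λ.fidelity Q - 1 - Real.log (Λ.fidelity Q))|
      ≤ 8 * Λ.errorProb ^ 2 := by
    intro Q
    have h1 := Λ.abs_fidelity_sub_one_le Q
    have h2 : 1 / 2 ≤ Λ.fidelity Q := by linarith [(abs_le.mp h1).1]
    rw [abs_mul, Pauli.abs_sign, one_mul]
    refine (abs_sub_one_sub_log_le h2).trans ?_
    rw [← sq_abs]
    nlinarith [abs_nonneg (Λ.fidelity Q - 1)]
  refine (Finset.sum_le_sum fun Q _ => hterm Q).trans (le_of_eq ?_)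
  have hcard : (Fintype.card (Pauli m) : ℝ) = 4 ^ m := by
    rw [Fintype.card_pi_const, show Fintype.card Pauli1 = 4 from rfl]
    push_cast; rfl
  rw [Finset.sum_const, Finset.card_univ, nsmul_eq_mul, hcard]

theorem sum_firstOrderRate {l : ℕ} (Q : Fin l → Pauli m) :
    ∑ k, Λ.firstOrderRate (Q k) =
      ∑ R, walshHadamard m (∑ k, Finsupp.single (Q k) (1 : ℝ)) R * Real.log (Λ.fidelity R) +
        ∑ k, if Q k = Pauli.id then (1 : ℝ) else 0 := by
  simp only [firstOrderRate, Finset.sum_add_distrib, map_sum, Finsupp.finsetSum_apply,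
    Finset.sum_mul]
  rw [Finset.sum_comm]
  congr 1
  refine Finset.sum_congr rfl fun k _ => ?_
  rw [sum_walshHadamard_mul]
  simp [Finsupp.single_apply]

/-- Pauli operators are eigenvectors of the adjoint of a Pauli channel. -/
theorem trace_toMatrix_mul_channel (Q : Pauli m) (A : Op m) :
    (Q.toMatrix * Λ.channel A).trace = (Λ.fidelity Q : ℂ) * (Q.toMatrix * A).trace := by
  rw [channel, Matrix.mul_sum, Matrix.trace_sum, fidelity, pauliFidelity, Complex.ofReal_sum,
    Finset.sum_mul]
  refine Finset.sum_congr rfl fun P _ => ?_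
  rw [Matrix.mul_smul, Matrix.trace_smul, Pauli.conjTranspose_toMatrix, ← Matrix.mul_assoc,
    Matrix.trace_mul_comm, ← Matrix.mul_assoc, ← Matrix.mul_assoc, P.toMatrix_mul_comm_sign Q,
    Matrix.smul_mul, Matrix.smul_mul, Matrix.mul_assoc Q.toMatrix, P.toMatrix_mul_self,
    Matrix.mul_one, Matrix.trace_smul]
  simp only [smul_eq_mul, Complex.ofReal_mul]
  ring

end PauliNoise

/-! ## Learnability of cycles -/

namespace NoiseModel

variable {m : ℕ} {ι : Type*} {G : ι → CliffordGate m}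

/-- The measurement of a Pauli operator after a sequence of layers. -/
noncomputable def pauliExperiment (layers : List (Layer m ι)) (Q : Pauli m) : Experiment m ι where
  layers := layers
  outcomes := 2
  povm := ![(2⁻¹ : ℂ) • (1 + Q.toMatrix), (2⁻¹ : ℂ) • (1 + -Q.toMatrix)]
  povm_posSemidef j := by
    fin_cases j
    · exact Pauli.half_one_add_posSemidef Q.conjTranspose_toMatrix Q.toMatrix_mul_self
    · exact Pauli.half_one_add_posSemidef
        (by rw [Matrix.conjTranspose_neg, Q.conjTranspose_toMatrix])
        (by rw [neg_mul_neg, Q.toMatrix_mul_self])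
  sum_povm := by
    rw [Fin.sum_univ_two, Matrix.cons_val_zero, Matrix.cons_val_one, Matrix.cons_val_zero,
      ← smul_add, add_add_add_comm, add_neg_cancel, add_zero, ← two_smul ℂ, smul_smul]
    simp

theorem prob_sub_prob_pauliExperiment (N : NoiseModel G) (layers : List (Layer m ι))
    (Q : Pauli m) :
    N.prob (pauliExperiment layers Q) (0 : Fin 2) - N.prob (pauliExperiment layers Q) (1 : Fin 2) =
      N.measNoise.fidelity Q * (Q.toMatrix * layers.foldl N.applyLayer N.ρ).trace.re := by
  rw [← Complex.re_ofReal_mul, ← PauliNoise.trace_toMatrix_mul_channel]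
  simp only [prob, pauliExperiment, Matrix.cons_val_zero, Matrix.cons_val_one]
  rw [← Complex.sub_re, ← Matrix.trace_sub, ← sub_mul, ← smul_sub, add_sub_add_left_eq_sub,
    sub_neg_eq_add, ← two_smul ℂ, smul_smul]
  simp

theorem Indistinguishable.pauli_expectation_eq {N₁ N₂ : NoiseModel G}
    (h : N₁.Indistinguishable N₂) (layers : List (Layer m ι)) (Q : Pauli m) :
    N₁.measNoise.fidelity Q * (Q.toMatrix * layers.foldl N₁.applyLayer N₁.ρ).trace.re =
      N₂.measNoise.fidelity Q * (Q.toMatrix * layers.foldl N₂.applyLayer N₂.ρ).trace.re := by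
  rw [← prob_sub_prob_pauliExperiment, ← prob_sub_prob_pauliExperiment]
  exact congrArg₂ _ (h _ _) (h _ _)

theorem trace_mul_conj (A U V : Op m) : (A * (U * V * Uᴴ)).trace = (Uᴴ * A * U * V).trace := by
  rw [← Matrix.mul_assoc, Matrix.trace_mul_comm]
  simp only [Matrix.mul_assoc]

/-- The Pauli expectation value after rotating the initial state by `V` and applying one noisy
gate. -/
theorem trace_mul_single_gate (N : NoiseModel G) (i : ι) {Q P : Pauli m}
    {V : Fin m → Matrix.unitaryGroup (Fin 2) ℂ} {s : ℝ}
    (hs : (G i).Uᴴ * Q.toMatrix * (G i).U = (s : ℂ) • ((G i).pullback Q).toMatrix)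
    (hV : (tensor fun j => (V j : Matrix (Fin 2) (Fin 2) ℂ))ᴴ * ((G i).pullback Q).toMatrix *
        (tensor fun j => (V j : Matrix (Fin 2) (Fin 2) ℂ)) = P.toMatrix) :
    (Q.toMatrix * [Layer.single V, Layer.gate i].foldl N.applyLayer N.ρ).trace.re =
      (N.gateNoise i).fidelity Q * (s * (P.toMatrix * N.ρ).trace.re) := by
  simp only [List.foldl_cons, List.foldl_nil, applyLayer, CliffordGate.channel]
  rw [PauliNoise.trace_toMatrix_mul_channel, trace_mul_conj, hs, Matrix.smul_mul, Matrix.trace_smul,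
    trace_mul_conj, hV, smul_eq_mul, Complex.re_ofReal_mul, Complex.re_ofReal_mul]

/-- Measuring `Q` after one gate and `P` after none both involve `Tr(Pρ)`, which drops out of the
comparison. -/
theorem Indistinguishable.fidelity_mul_eq {N₁ N₂ : NoiseModel G} (h : N₁.Indistinguishable N₂)
    (i : ι) {Q P : Pauli m} (hP : P.pattern = ((G i).pullback Q).pattern)
    (hρ : (P.toMatrix * N₁.ρ).trace ≠ 0) :
    N₁.measNoise.fidelity Q * (N₁.gateNoise i).fidelity Q * N₂.measNoise.fidelity P =
      N₂.measNoise.fidelity Q * (N₂.gateNoise i).fidelity Q * N₁.measNoise.fidelity P := by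
  obtain ⟨V, hV⟩ := Pauli.exists_unitary_conj hP.symm
  obtain ⟨s, hs0, hs⟩ := (G i).pullback_spec_sign Q
  have h1 := h.pauli_expectation_eq [Layer.single V, Layer.gate i] Q
  have h0 := h.pauli_expectation_eq [] P
  rw [N₁.trace_mul_single_gate i hs hV, N₂.trace_mul_single_gate i hs hV] at h1
  simp only [List.foldl_nil] at h0
  have hre : (P.toMatrix * N₁.ρ).trace.re ≠ 0 := fun hre =>
    hρ (Complex.ext hre (P.trace_mul_im_eq_zero N₁.ρ_posSemidef.isHermitian))
  apply mul_right_cancel₀ (mul_ne_zero hs0 hre)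
  -- This eliminates `Tr(Pρ)` of the second model, so only the first needs nonzero overlap.
  linear_combination N₂.measNoise.fidelity P * h1 -
    s * N₂.measNoise.fidelity Q * (N₂.gateNoise i).fidelity Q * h0

/-- For indistinguishable noise models, the difference of the log-fidelities of a gate is a
coboundary of the pattern transfer graph. -/
theorem Indistinguishable.exists_potential {N₁ N₂ : NoiseModel G} (h : N₁.Indistinguishable N₂)
    (i : ι) : ∃ φ : Pattern m → ℝ, ∀ Q : Pauli m,
      Real.log ((N₁.gateNoise i).fidelity Q) - Real.log ((N₂.gateNoise i).fidelity Q) =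
        φ ((G i).edgeTarget Q) - φ ((G i).edgeSource Q) := by
  choose P hP hρ using N₁.ρ_overlap
  refine ⟨fun v => Real.log (N₂.measNoise.fidelity (P v)) - Real.log (N₁.measNoise.fidelity (P v)),
    fun Q => ?_⟩
  have hmul := h.fidelity_mul_eq i (hP ((G i).edgeSource Q)) (hρ _)
  -- Symmetry of the measurement noise replaces `Q` by the chosen representative of its pattern,
  -- making the potential a function of vertices.
  rw [← N₁.measNoise_symm _ Q (hP ((G i).edgeTarget Q)),
    ← N₂.measNoise_symm _ Q (hP ((G i).edgeTarget Q))] at hmul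
  have hpos : ∀ (Λ : PauliNoise m) (R : Pauli m), Λ.fidelity R ≠ 0 :=
    fun Λ R => (Λ.fidelity_pos R).ne'
  have hlog := congrArg Real.log hmul
  rw [Real.log_mul (mul_ne_zero (hpos _ _) (hpos _ _)) (hpos _ _),
    Real.log_mul (hpos _ _) (hpos _ _),
    Real.log_mul (mul_ne_zero (hpos _ _) (hpos _ _)) (hpos _ _),
    Real.log_mul (hpos _ _) (hpos _ _)] at hlog
  linarith

end NoiseModel

/-- The log-fidelity functional of every cycle is learnable. -/
theorem learnable_sum_mul_log_fidelity {m : ℕ} {ι : Type*} {G : ι → CliffordGate m} (i : ι)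
    {z : Pauli m →₀ ℝ} (hz : z ∈ (G i).cycleSpace) :
    Learnable fun N : NoiseModel G => ∑ R, z R * Real.log ((N.gateNoise i).fidelity R) := by
  intro N₁ N₂ h
  obtain ⟨φ, hφ⟩ := h.exists_potential i
  rw [← sub_eq_zero, ← Finset.sum_sub_distrib]
  simp only [← mul_sub, hφ]
  exact ((G i).mem_cycleSpace_iff z).mp hz φ

end PauliLearning

theorem theorem3 {m : ℕ} {ι : Type*} (G : ι → CliffordGate m) (i : ι) :
    (∀ (l : ℕ) (v : Fin (l + 1) → Pattern m) (Q : Fin l → Pauli m), (G i).IsCycle v Q →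
      Learnable (fun N : NoiseModel G => ∑ k, (N.gateNoise i).firstOrderRate (Q k)) ∧
      EqToFirstOrder i (fun N : NoiseModel G => ∑ k, (N.gateNoise i).rate (Q k))
        (fun N : NoiseModel G => ∑ k, (N.gateNoise i).firstOrderRate (Q k))) ∧
    (G i).cycleSpace.map (walshHadamard m) = (G i).cycleSpace := by
  refine ⟨fun l v Q hQ => ⟨fun N₁ N₂ h => ?_, l * 8, 1 / 4, by norm_num, fun N hN => ?_⟩,
    map_walshHadamard_cycleSpace (G i)⟩
  · simp only [PauliNoise.sum_firstOrderRate]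
    -- The remaining sum of `δ`-terms is the same for both models.
    congr 1
    exact learnable_sum_mul_log_fidelity i
      (walshHadamard_mem_cycleSpace (G i) hQ.sum_single_mem_cycleSpace) N₁ N₂ h
  · rw [← Finset.sum_sub_distrib]
    refine (Finset.abs_sum_le_sum_abs _ _).trans ((Finset.sum_le_sum fun k _ =>
      (N.gateNoise i).abs_rate_sub_firstOrderRate_le hN (Q k)).trans (le_of_eq ?_))
    rw [Finset.sum_const, Finset.card_univ, Fintype.card_fin, nsmul_eq_mul, mul_assoc]
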